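/- Let $X$ be an infinite-dimensional complex Banach space and let $T\in L(X)$ be a bounded linear operator on $X$. Write $\sigma(T)$ for the spectrum of $T$, $\sigma_a(T)=\{\lambda\in\mathbb{C}: T-\lambda I \text{ is not bounded below}\}$ for the approximate spectrum, and $\sigma_p(T)$ for the set of eigenvalues of $T$. An operator $S\in L(X)$ is a Weyl operator if it is Fredholm of index $0$. It is upper semi-Weyl if its kernel is finite-dimensional, its range is closed, and its index $\dim\ker S-\operatorname{codim} S(X)\in\mathbb{Z}\cup\{-\infty\}$ is $\le 0$. Let $\sigma_w(T)$ (respectively $\sigma_{uw}(T)$) be the set of $\lambda\in\mathbb{C}$ such that $T-\lambda I$ is not Weyl (respectively not upper semi-Weyl). For $A\subset\mathbb{C}$ let $\operatorname{iso}A$ be the set of isolated points of $A$. Put $$\Delta(T)=\sigma(T)\setminus\sigma_w(T),\qquad \Delta_a(T)=\sigma_a(T)\setminus\sigma_{uw}(T),$$ $$E(T)=\operatorname{iso}\sigma(T)\cap\sigma_p(T),\qquad E_a(T)=\operatorname{iso}\sigma_a(T)\cap\sigma_p(T).$$ The operator $T$ satisfies property $(UW_E)$ if $\Delta_a(T)=E(T)$,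 and property $(Z_{E_a})$ if $\Delta(T)=E_a(T)$. Then the following statements are equivalent: (i) $T$ satisfies property $(UW_E)$ and $E_a(T)\cap\sigma_{uw}(T)=\emptyset$; (ii) $T$ satisfies property $(Z_{E_a})$ and $\sigma_w(T)\setminus\sigma_{uw}(T)=\sigma(T)\setminus\sigma_a(T)$; (iii) $T$ satisfies property $(Z_{E_a})$ and $\Delta_a(T)\cap\sigma_w(T)=\emptyset$. -/

import Mathlib

namespace SpectralSets

/-- The isolated points `iso A` of a set `A` of complex numbers: the points of `A` that are not
accumulation points of `A`. -/
def isoPts (A : Set ℂ) : Set ℂ := A \ derivedSet A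

section Operators

variable {X : Type*} [NormedAddCommGroup X] [NormedSpace ℂ X]

/-- `S` is bounded below: `‖S x‖ ≥ c ‖x‖` for all `x`, for some constant `c > 0`. -/
def IsBoundedBelow (S : X →L[ℂ] X) : Prop :=
  ∃ c : ℝ, 0 < c ∧ ∀ x : X, c * ‖x‖ ≤ ‖S x‖

/-- `S` is upper semi-Fredholm: its kernel is finite-dimensional and its range is closed. -/
structure IsUpperSemiFredholm (S : X →L[ℂ] X) : Prop where
  finite_ker : FiniteDimensional ℂ S.ker
  isClosed_range : IsClosed (S.range : Set X)

/-- `S` is upper semi-Weyl: upper semi-Fredholm of index `≤ 0`. When the range has infinite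
codimension the index is `-∞`, and nothing further is required; when the codimension is finite,
the index is the integer `dim ker S - codim range S`. -/
structure IsUpperSemiWeyl (S : X →L[ℂ] X) : Prop where
  isUpperSemiFredholm : IsUpperSemiFredholm S
  index_nonpos : FiniteDimensional ℂ (X ⧸ S.range) → (S : X →ₗ[ℂ] X).index ≤ 0

/-- `S` is a Weyl operator: a Fredholm operator of index `0`. -/
structure IsWeyl (S : X →L[ℂ] X) : Prop where
  isFredholm : S.IsFredholm
  index_eq_zero : (S : X →ₗ[ℂ] X).index = 0

/-- The approximate (point) spectrum `σ_a(T)`. -/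
def approxSpectrum (T : X →L[ℂ] X) : Set ℂ :=
  {z | ¬ IsBoundedBelow (T - z • (1 : X →L[ℂ] X))}

/-- The set `σ_p(T)` of eigenvalues. -/
def pointSpectrum (T : X →L[ℂ] X) : Set ℂ :=
  {z | Module.End.HasEigenvalue (T : Module.End ℂ X) z}

/-- The Weyl spectrum `σ_w(T)`. -/
def weylSpectrum (T : X →L[ℂ] X) : Set ℂ :=
  {z | ¬ IsWeyl (T - z • (1 : X →L[ℂ] X))}

/-- The upper semi-Weyl spectrum `σ_uw(T)`. -/
def upperSemiWeylSpectrum (T : X →L[ℂ] X) : Set ℂ :=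
  {z | ¬ IsUpperSemiWeyl (T - z • (1 : X →L[ℂ] X))}

/-- `Δ(T) = σ(T) \ σ_w(T)`. -/
def Delta (T : X →L[ℂ] X) : Set ℂ := spectrum ℂ T \ weylSpectrum T

/-- `Δ_a(T) = σ_a(T) \ σ_uw(T)`. -/
def DeltaA (T : X →L[ℂ] X) : Set ℂ := approxSpectrum T \ upperSemiWeylSpectrum T

/-- `E(T) = iso σ(T) ∩ σ_p(T)`. -/
def E (T : X →L[ℂ] X) : Set ℂ := isoPts (spectrum ℂ T) ∩ pointSpectrum T

/-- `E_a(T) = iso σ_a(T) ∩ σ_p(T)`. -/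
def Ea (T : X →L[ℂ] X) : Set ℂ := isoPts (approxSpectrum T) ∩ pointSpectrum T

/-- Property `(UW_E)`: `Δ_a(T) = E(T)`. -/
def PropertyUWE (T : X →L[ℂ] X) : Prop := DeltaA T = E T

/-- Property `(Z_{E_a})`: `Δ(T) = E_a(T)`. -/
def PropertyZEa (T : X →L[ℂ] X) : Prop := Delta T = Ea T

end Operators

end SpectralSets

/-!
Three observations hold for every operator `T`. A Weyl operator that is injective is invertible, so
`Δ(T)` consists of eigenvalues and `Δ(T) ⊆ Δ_a(T)`. An operator that is bounded below is upper
semi-Weyl. An isolated point of `σ(T)` that is an eigenvalue is isolated in `σ_a(T)`, so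
`E(T) ⊆ E_a(T)`. The equivalence of the two conditions that contain property `(Z_{E_a})` follows
from these formally (`weylSpectrum_diff_eq_iff`), and the equivalence with the one that contains
property `(UW_E)` needs in addition two facts about an upper semi-Weyl operator `S = T - z`:

* if `z` is isolated in `σ(T)`, then `S` is Weyl;
* if `S` is Weyl and `z` is isolated in `σ_a(T)`, then `z` is isolated in `σ(T)`.

These are local instances of the stability of the semi-Fredholm index, and they are proved without
the general theory. As the index of `S` is at most `0`, the kernel of `S` embeds linearly into
a complement of its range. Composing with a projection onto the kernel gives a finite-rank operator
`F` such that `S + F` is bounded below, and `S + F` is invertible exactly when `S` is Weyl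
(`IsUpperSemiWeyl.exists_finiteRank_add`). Near an operator that is bounded below all operators are
injective, and if there are invertible ones among those close enough, it is invertible itself
(`IsBoundedBelow.exists_perturbation`). Finally, a finite-rank perturbation of an invertible
operator is invertible as soon as it is injective (`isUnit_of_injective_of_isUnit_add`). Both facts
come from comparing `T - w` with `T - w + F` for `w` close to `z`.
-/

namespace SpectralSets

open Filter Topology

variable {X : Type*} [NormedAddCommGroup X] [NormedSpace ℂ X]

/-! ### Operators that are bounded below -/

lemma IsBoundedBelow.injective {S : X →L[ℂ] X} (h : IsBoundedBelow S) :
    Function.Injective S := by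
  obtain ⟨c, hc, h⟩ := h
  refine (injective_iff_map_eq_zero S).2 fun x hx ↦ ?_
  have := h x
  rw [hx, norm_zero] at this
  exact norm_le_zero_iff.1 (nonpos_of_mul_nonpos_right this hc)

variable [CompleteSpace X]

lemma isBoundedBelow_of_injective_of_isClosed_range {S : X →L[ℂ] X} (hS : Function.Injective S)
    (hc : IsClosed (S.range : Set X)) : IsBoundedBelow S := by
  obtain ⟨K, hK⟩ := S.antilipschitz_of_injective_of_isClosed_range hS
    (by rwa [LinearMap.coe_range] at hc)
  refine ⟨(K + 1 : ℝ)⁻¹, by positivity, fun x ↦ ?_⟩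
  rw [inv_mul_le_iff₀ (by positivity)]
  nlinarith [S.bound_of_antilipschitz hK x, norm_nonneg (S x)]

lemma IsBoundedBelow.isClosed_range {S : X →L[ℂ] X} (h : IsBoundedBelow S) :
    IsClosed (S.range : Set X) := by
  obtain ⟨c, hc, h⟩ := h
  have hK : AntilipschitzWith (Real.toNNReal c⁻¹) S := by
    refine S.antilipschitz_of_bound fun x ↦ ?_
    rw [Real.coe_toNNReal _ (by positivity), ← div_eq_inv_mul, le_div_iff₀ hc, mul_comm]
    exact h x
  rw [LinearMap.coe_range]
  exact hK.isClosed_range S.uniformContinuous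

lemma isBoundedBelow_of_isUnit {S : X →L[ℂ] X} (h : IsUnit S) : IsBoundedBelow S := by
  have hb := ContinuousLinearMap.isUnit_iff_bijective.1 h
  refine isBoundedBelow_of_injective_of_isClosed_range hb.1 ?_
  rw [LinearMap.range_eq_top.2 hb.2]
  exact isClosed_univ

/-- If `V` is bounded below, then every operator close to `V` is injective, and `V` is invertible
as soon as one of those operators is. -/
lemma IsBoundedBelow.exists_perturbation {V : X →L[ℂ] X} (hV : IsBoundedBelow V) :
    ∃ ε > 0, ∀ U : X →L[ℂ] X, ‖U - V‖ < ε → Function.Injective U ∧ (IsUnit U → IsUnit V) := by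
  obtain ⟨c, hc, h⟩ := hV
  refine ⟨c / 2, by positivity, fun U hU ↦ ?_⟩
  have hlow : ∀ x, c / 2 * ‖x‖ ≤ ‖U x‖ := fun x ↦ by
    have h1 := (U - V).le_opNorm x
    have h2 : ‖V x‖ ≤ ‖U x‖ + ‖(U - V) x‖ := by
      have := norm_sub_le (U x) ((U - V) x)
      simpa using this
    nlinarith [h x, norm_nonneg x]
  refine ⟨IsBoundedBelow.injective ⟨c / 2, by positivity, hlow⟩, ?_⟩
  rintro ⟨u, rfl⟩
  have hinv : ‖((u⁻¹ : (X →L[ℂ] X)ˣ) : X →L[ℂ] X)‖ ≤ (c / 2)⁻¹ := by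
    refine ContinuousLinearMap.opNorm_le_bound _ (by positivity) fun y ↦ ?_
    have := hlow (((u⁻¹ : (X →L[ℂ] X)ˣ) : X →L[ℂ] X) y)
    rw [← mul_apply_eq_comp, u.mul_inv, one_apply_eq_self] at this
    rwa [← div_eq_inv_mul, le_div_iff₀ (by positivity), mul_comm]
  -- `V = u (1 - u⁻¹ (u - V))`, and the second factor is a Neumann perturbation of the identity.
  have hlt : ‖((u⁻¹ : (X →L[ℂ] X)ˣ) : X →L[ℂ] X) * ((u : X →L[ℂ] X) - V)‖ < 1 := by
    calc _ ≤ (c / 2)⁻¹ * ‖(u : X →L[ℂ] X) - V‖ :=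
          (norm_mul_le _ _).trans (by gcongr)
      _ < (c / 2)⁻¹ * (c / 2) := by gcongr
      _ = 1 := inv_mul_cancel₀ (by positivity)
  have := u.isUnit.mul (Units.oneSub _ hlt).isUnit
  simpa [mul_sub] using this

/-! ### Finite-rank perturbations -/

/-- The finite-dimensional case of the Fredholm alternative: an injective operator that differs
from an invertible one by a finite-rank operator is invertible. -/
lemma isUnit_of_injective_of_isUnit_add {S F : X →L[ℂ] X} (hS : Function.Injective S)
    (hF : FiniteDimensional ℂ F.range) (hU : IsUnit (S + F)) : IsUnit S := by
  have hb := ContinuousLinearMap.isUnit_iff_bijective.1 hU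
  refine ContinuousLinearMap.isUnit_iff_bijective.2 ⟨hS, ?_⟩
  let e : X ≃ₗ[ℂ] X := LinearEquiv.ofBijective ((S + F : X →L[ℂ] X) : X →ₗ[ℂ] X) hb
  have he : ∀ x, e x = S x + F x := fun x ↦ rfl
  -- `A = (S + F)⁻¹ S` differs from the identity by `K = (S + F)⁻¹ F`; it maps the range `R` of `K`
  -- into itself, hence onto itself.
  let R : Submodule ℂ X := F.range.map (e.symm : X →ₗ[ℂ] X)
  have hR : FiniteDimensional ℂ R := inferInstance
  let A : X →ₗ[ℂ] X := (e.symm : X →ₗ[ℂ] X) ∘ₗ (S : X →ₗ[ℂ] X)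
  have hA : ∀ x, A x = e.symm (S x) := fun x ↦ rfl
  have hAK : ∀ x, A x = x - e.symm (F x) := fun x ↦ by
    rw [hA, eq_sub_iff_add_eq, ← map_add, ← he, e.symm_apply_apply]
  have hK : ∀ x, e.symm (F x) ∈ R := fun x ↦ ⟨F x, ⟨x, rfl⟩, rfl⟩
  have hAR : ∀ x ∈ R, A x ∈ R := fun x hx ↦ by
    rw [hAK]; exact R.sub_mem hx (hK x)
  have hAinj : Function.Injective A := e.symm.injective.comp hS
  have hsurj : Function.Surjective (A.restrict hAR) :=
    LinearMap.injective_iff_surjective.1 fun x y hxy ↦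
      Subtype.ext (hAinj (congrArg Subtype.val hxy))
  intro y
  obtain ⟨r, hr⟩ := hsurj ⟨e.symm (F (e.symm y)), hK _⟩
  have hr' : A r = e.symm (F (e.symm y)) := congrArg Subtype.val hr
  refine ⟨e.symm y + r, e.symm.injective ?_⟩
  rw [← hA, map_add, hr', hAK, sub_add_cancel]

omit [CompleteSpace X] in
lemma IsUpperSemiWeyl.rank_ker_le {S : X →L[ℂ] X} (hS : IsUpperSemiWeyl S) :
    Module.rank ℂ S.ker ≤ Module.rank ℂ (X ⧸ S.range) := by
  have := hS.isUpperSemiFredholm.finite_ker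
  by_cases hq : FiniteDimensional ℂ (X ⧸ S.range)
  · have h := hS.index_nonpos hq
    rw [LinearMap.index] at h
    rw [← Module.finrank_eq_rank, ← Module.finrank_eq_rank]
    exact_mod_cast (by linarith : (Module.finrank ℂ S.ker : ℤ) ≤ Module.finrank ℂ (X ⧸ S.range))
  · have h1 : Module.rank ℂ S.ker < Cardinal.aleph0 := Module.rank_lt_aleph0 ℂ _
    have h2 : Cardinal.aleph0 ≤ Module.rank ℂ (X ⧸ S.range) :=
      not_lt.1 fun h ↦ hq (Module.rank_lt_aleph0_iff.1 h)
    exact h1.le.trans h2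

lemma isStrictMap_of_isClosed_range {S : X →L[ℂ] X} (hS : IsClosed (S.range : Set X)) :
    IsStrictMap S := by
  have : CompleteSpace S.range := hS.completeSpace_coe
  rw [isStrictMap_iff_isQuotientMap_rangeFactorization]
  exact S.rangeRestrict.isQuotientMap (by rintro ⟨_, x, rfl⟩; exact ⟨x, rfl⟩)

/-- An upper semi-Weyl operator becomes bounded below after adding a suitable finite-rank operator,
and the sum is invertible exactly when the given operator is Weyl. -/
lemma IsUpperSemiWeyl.exists_finiteRank_add {S : X →L[ℂ] X} (hS : IsUpperSemiWeyl S) :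
    ∃ F : X →L[ℂ] X, FiniteDimensional ℂ F.range ∧ IsBoundedBelow (S + F) ∧
      (IsUnit (S + F) ↔ IsWeyl S) := by
  have hker := hS.isUpperSemiFredholm.finite_ker
  have hcl := hS.isUpperSemiFredholm.isClosed_range
  obtain ⟨P, hP⟩ : S.ker.ClosedComplemented := .of_finiteDimensional S.ker
  obtain ⟨ψ, hψ⟩ := rank_le_iff_exists_linearMap.1 hS.rank_ker_le
  obtain ⟨s, hs⟩ := S.range.mkQ.exists_rightInverse_of_surjective S.range.range_mkQ
  have hs' : ∀ q, S.range.mkQ (s q) = q := fun q ↦ LinearMap.congr_fun hs q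
  -- `s` identifies the quotient with an algebraic complement of the range, into which `φ` embeds
  -- the kernel.
  let φ : S.ker →L[ℂ] X := LinearMap.toContinuousLinearMap (s ∘ₗ ψ)
  have hφ : ∀ n, S.range.mkQ (φ n) = ψ n := fun n ↦ hs' _
  have hmk : ∀ x, S.range.mkQ (S x) = 0 := fun x ↦
    (Submodule.Quotient.mk_eq_zero _).2 ⟨x, rfl⟩
  have hSker : ∀ n : S.ker, S n = 0 := fun n ↦ n.2
  let F : X →L[ℂ] X := φ ∘L P
  have hV : ∀ x, (S + F) x = S x + φ (P x) := fun x ↦ rfl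
  have hVmk : ∀ x, S.range.mkQ ((S + F) x) = ψ (P x) := fun x ↦ by
    rw [hV, map_add, hmk, zero_add, hφ]
  have hcomb : ∀ (x : X) (n : S.ker), (S + F) (x - P x + n) = S x + φ n := fun x n ↦ by
    rw [hV]; simp [hP, hSker]
  have hFfin : FiniteDimensional ℂ F.range := by
    refine Submodule.finiteDimensional_of_le (S₂ := φ.range) ?_
    rintro _ ⟨x, rfl⟩
    exact ⟨P x, rfl⟩
  have hinj : Function.Injective (S + F) := by
    refine (injective_iff_map_eq_zero _).2 fun x hx ↦ ?_
    have hPx : P x = 0 := hψ (by rw [← hVmk, hx, map_zero, map_zero])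
    have hSx : S x = 0 := by simpa [hV, hPx] using hx
    have : P x = ⟨x, hSx⟩ := hP ⟨x, hSx⟩
    simpa [hPx] using (congrArg Subtype.val this).symm
  have hrange : (S + F).range = S.range ⊔ φ.range := by
    apply le_antisymm
    · rintro _ ⟨x, rfl⟩
      exact Submodule.add_mem_sup ⟨x, rfl⟩ ⟨P x, rfl⟩
    · refine sup_le ?_ ?_
      · rintro _ ⟨x, rfl⟩
        exact ⟨x - P x + (0 : S.ker), by simpa using hcomb x 0⟩
      · rintro _ ⟨n, rfl⟩
        exact ⟨0 - P 0 + n, by simpa using hcomb 0 n⟩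
  refine ⟨F, hFfin, isBoundedBelow_of_injective_of_isClosed_range hinj ?_, fun hU ↦ ?_, fun hW ↦ ?_⟩
  · rw [hrange]
    exact Submodule.isClosed_sup_finiteDimensional _ _ hcl
  · have hb := ContinuousLinearMap.isUnit_iff_bijective.1 hU
    have hψs : Function.Surjective ψ := fun q ↦ by
      obtain ⟨y, rfl⟩ := S.range.mkQ_surjective q
      obtain ⟨x, rfl⟩ := hb.2 y
      exact ⟨P x, (hVmk x).symm⟩
    let e := LinearEquiv.ofBijective ψ ⟨hψ, hψs⟩
    have hq : FiniteDimensional ℂ (X ⧸ S.range) := e.finiteDimensional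
    exact ⟨⟨isStrictMap_of_isClosed_range hcl, hcl, hker, hq, ⟨P, hP⟩⟩, by
      rw [LinearMap.index, sub_eq_zero]; exact_mod_cast e.finrank_eq⟩
  · have hq : FiniteDimensional ℂ (X ⧸ S.range) := hW.isFredholm.finite_coker
    have hidx := hW.index_eq_zero
    rw [LinearMap.index, sub_eq_zero] at hidx
    have hψs : Function.Surjective ψ :=
      (LinearMap.injective_iff_surjective_of_finrank_eq_finrank (by exact_mod_cast hidx)).1 hψ
    refine ContinuousLinearMap.isUnit_iff_bijective.2 ⟨hinj, fun y ↦ ?_⟩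
    obtain ⟨n, hn⟩ := hψs (S.range.mkQ y)
    obtain ⟨x, hx⟩ : y - φ n ∈ S.range := by
      rw [← Submodule.Quotient.mk_eq_zero, ← Submodule.mkQ_apply, map_sub, hφ, hn, sub_self]
    refine ⟨x - P x + n, ?_⟩
    rw [hcomb]
    exact add_eq_of_eq_sub hx

/-! ### Weyl and upper semi-Weyl operators -/

omit [CompleteSpace X] in
lemma IsWeyl.isUpperSemiWeyl {S : X →L[ℂ] X} (h : IsWeyl S) : IsUpperSemiWeyl S :=
  ⟨⟨h.isFredholm.finite_ker, h.isFredholm.isClosed_range⟩, fun _ ↦ h.index_eq_zero.le⟩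

lemma IsBoundedBelow.isUpperSemiWeyl {S : X →L[ℂ] X} (h : IsBoundedBelow S) :
    IsUpperSemiWeyl S := by
  have hker : S.ker = ⊥ := LinearMap.ker_eq_bot.2 h.injective
  refine ⟨⟨by rw [hker]; infer_instance, h.isClosed_range⟩, fun _ ↦ ?_⟩
  rw [LinearMap.index, hker]
  simp

lemma IsWeyl.isUnit_of_injective {S : X →L[ℂ] X} (h : IsWeyl S) (hS : Function.Injective S) :
    IsUnit S := by
  obtain ⟨F, hF, -, hU⟩ := h.isUpperSemiWeyl.exists_finiteRank_add
  exact isUnit_of_injective_of_isUnit_add hS hF (hU.2 h)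

/-- An upper semi-Weyl operator that is a limit of invertible operators is Weyl. -/
lemma IsUpperSemiWeyl.isWeyl_of_frequently_isUnit {S : X →L[ℂ] X} (hS : IsUpperSemiWeyl S)
    {ι : Type*} {l : Filter ι} {U : ι → X →L[ℂ] X} (hU : Tendsto U l (𝓝 S))
    (h : ∃ᶠ i in l, IsUnit (U i)) : IsWeyl S := by
  obtain ⟨F, hF, hV, hiff⟩ := hS.exists_finiteRank_add
  obtain ⟨ε, hε, hpert⟩ := hV.exists_perturbation
  obtain ⟨i, hi, hiε⟩ := (h.and_eventually (Metric.tendsto_nhds.1 hU ε hε)).exists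
  obtain ⟨hinj, hunit⟩ := hpert (U i + F) (by simpa [dist_eq_norm] using hiε)
  -- `U i + F` is an injective finite-rank perturbation of `U i`.
  have hneg : FiniteDimensional ℂ (-F : X →L[ℂ] X).range := by
    rw [ContinuousLinearMap.toLinearMap_neg, LinearMap.range_neg]; exact hF
  exact hiff.1 (hunit (isUnit_of_injective_of_isUnit_add hinj hneg (by simpa using hi)))

/-- Near a Weyl operator, injective operators are invertible. -/
lemma IsWeyl.eventually_isUnit_of_injective {S : X →L[ℂ] X} (hS : IsWeyl S) :
    ∀ᶠ U : X →L[ℂ] X in 𝓝 S, Function.Injective U → IsUnit U := by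
  obtain ⟨F, hF, -, hiff⟩ := hS.isUpperSemiWeyl.exists_finiteRank_add
  have hopen : {V : X →L[ℂ] X | IsUnit V} ∈ 𝓝 (S + F) := Units.isOpen.mem_nhds (hiff.2 hS)
  have hcont : Tendsto (fun U : X →L[ℂ] X ↦ U + F) (𝓝 S) (𝓝 (S + F)) :=
    (continuous_id.add continuous_const).tendsto S
  filter_upwards [hcont hopen] with U hU hinj
  exact isUnit_of_injective_of_isUnit_add hinj hF hU

/-! ### The parts of the spectrum -/

omit [CompleteSpace X] in
lemma mem_spectrum_iff_not_isUnit_sub {T : X →L[ℂ] X} {z : ℂ} :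
    z ∈ spectrum ℂ T ↔ ¬ IsUnit (T - z • (1 : X →L[ℂ] X)) := by
  rw [spectrum.mem_iff, Algebra.algebraMap_eq_smul_one, IsUnit.sub_iff]

omit [CompleteSpace X] in
lemma mem_pointSpectrum_iff {T : X →L[ℂ] X} {z : ℂ} :
    z ∈ pointSpectrum T ↔ ¬ Function.Injective (T - z • (1 : X →L[ℂ] X)) := by
  rw [pointSpectrum, Set.mem_ofPred_eq, Module.End.HasEigenvalue, Module.End.HasUnifEigenvalue,
    Module.End.genEigenspace_one, Ne, LinearMap.ker_eq_bot]
  rfl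

omit [CompleteSpace X] in
lemma pointSpectrum_subset_approxSpectrum (T : X →L[ℂ] X) :
    pointSpectrum T ⊆ approxSpectrum T := fun _ hz hb ↦
  mem_pointSpectrum_iff.1 hz hb.injective

lemma approxSpectrum_subset_spectrum (T : X →L[ℂ] X) : approxSpectrum T ⊆ spectrum ℂ T :=
  fun _ hz ↦ mem_spectrum_iff_not_isUnit_sub.2 fun h ↦ hz (isBoundedBelow_of_isUnit h)

lemma upperSemiWeylSpectrum_subset_approxSpectrum (T : X →L[ℂ] X) :
    upperSemiWeylSpectrum T ⊆ approxSpectrum T := fun _ hz hb ↦ hz hb.isUpperSemiWeyl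

omit [CompleteSpace X] in
lemma upperSemiWeylSpectrum_subset_weylSpectrum (T : X →L[ℂ] X) :
    upperSemiWeylSpectrum T ⊆ weylSpectrum T := fun _ hz hb ↦ hz hb.isUpperSemiWeyl

lemma Delta_subset_approxSpectrum (T : X →L[ℂ] X) : Delta T ⊆ approxSpectrum T := by
  rintro z ⟨hz, hw⟩
  refine pointSpectrum_subset_approxSpectrum T (mem_pointSpectrum_iff.2 fun hinj ↦ ?_)
  exact mem_spectrum_iff_not_isUnit_sub.1 hz ((not_not.1 hw).isUnit_of_injective hinj)

lemma Delta_subset_DeltaA (T : X →L[ℂ] X) : Delta T ⊆ DeltaA T := fun _ hz ↦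
  ⟨Delta_subset_approxSpectrum T hz, fun h ↦ hz.2 (upperSemiWeylSpectrum_subset_weylSpectrum T h)⟩

/-- An eigenvalue that is isolated in the spectrum is isolated in the smaller approximate
spectrum. -/
lemma E_subset_Ea (T : X →L[ℂ] X) : E T ⊆ Ea T := fun _ hz ↦
  ⟨⟨pointSpectrum_subset_approxSpectrum T hz.2, fun h ↦
    hz.1.2 (derivedSet_mono _ _ (approxSpectrum_subset_spectrum T) h)⟩, hz.2⟩

lemma eventually_notMem_of_mem_isoPts {A : Set ℂ} {z : ℂ} (hz : z ∈ isoPts A) :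
    ∀ᶠ w in 𝓝[≠] z, w ∉ A := by
  simpa [mem_derivedSet, accPt_iff_frequently_nhdsNE] using hz.2

omit [CompleteSpace X] in
lemma tendsto_sub_smul_one (T : X →L[ℂ] X) (z : ℂ) :
    Tendsto (fun w : ℂ ↦ T - w • (1 : X →L[ℂ] X)) (𝓝[≠] z) (𝓝 (T - z • (1 : X →L[ℂ] X))) :=
  ((continuous_const.sub (continuous_id.smul continuous_const)).tendsto z).mono_left
    nhdsWithin_le_nhds

lemma notMem_weylSpectrum_of_mem_isoPts_spectrum {T : X →L[ℂ] X} {z : ℂ}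
    (hz : z ∈ isoPts (spectrum ℂ T)) (hu : z ∉ upperSemiWeylSpectrum T) : z ∉ weylSpectrum T := by
  refine not_not.2 ((not_not.1 hu).isWeyl_of_frequently_isUnit (tendsto_sub_smul_one T z) ?_)
  refine ((eventually_notMem_of_mem_isoPts hz).mono fun w hw ↦ ?_).frequently
  simpa [mem_spectrum_iff_not_isUnit_sub] using hw

lemma mem_isoPts_spectrum_of_notMem_weylSpectrum {T : X →L[ℂ] X} {z : ℂ}
    (hz : z ∈ isoPts (approxSpectrum T)) (hw : z ∉ weylSpectrum T) :
    z ∈ isoPts (spectrum ℂ T) := by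
  refine ⟨approxSpectrum_subset_spectrum T hz.1, ?_⟩
  rw [mem_derivedSet, accPt_iff_frequently_nhdsNE, not_frequently]
  filter_upwards [eventually_notMem_of_mem_isoPts hz,
    (tendsto_sub_smul_one T z).eventually (not_not.1 hw).eventually_isUnit_of_injective]
    with w hwa hwu
  rw [mem_spectrum_iff_not_isUnit_sub, not_not]
  exact hwu (not_not.1 hwa : IsBoundedBelow _).injective

/-- The inclusion `σ(T) \ σ_a(T) ⊆ σ_w(T) \ σ_uw(T)` always holds, and a point of the right-hand
side that lies in `σ_a(T)` is a common point of `Δ_a(T)` and `σ_w(T)`. -/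
lemma weylSpectrum_diff_eq_iff (T : X →L[ℂ] X) :
    weylSpectrum T \ upperSemiWeylSpectrum T = spectrum ℂ T \ approxSpectrum T ↔
      DeltaA T ∩ weylSpectrum T = ∅ := by
  rw [← Set.disjoint_iff_inter_eq_empty]
  refine ⟨fun h ↦ Set.disjoint_left.2 fun z hz hw ↦ ?_, fun h ↦ Set.Subset.antisymm ?_ ?_⟩
  · have : z ∈ weylSpectrum T \ upperSemiWeylSpectrum T := ⟨hw, hz.2⟩
    rw [h] at this
    exact this.2 hz.1
  · rintro z ⟨hw, hu⟩
    have ha : z ∉ approxSpectrum T := fun ha ↦ Set.disjoint_left.1 h ⟨ha, hu⟩ hw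
    -- An invertible operator is Weyl, being the limit of a constant family of invertible operators.
    refine ⟨mem_spectrum_iff_not_isUnit_sub.2 fun hunit ↦ hw ?_, ha⟩
    exact (not_not.1 hu : IsUpperSemiWeyl _).isWeyl_of_frequently_isUnit
      (l := (⊤ : Filter Unit)) tendsto_const_nhds (Frequently.of_forall fun _ ↦ hunit)
  · rintro z ⟨hz, ha⟩
    exact ⟨by_contra fun hw ↦ ha (Delta_subset_approxSpectrum T ⟨hz, hw⟩),
      fun hu ↦ ha (upperSemiWeylSpectrum_subset_approxSpectrum T hu)⟩

lemma propertyZEa_and_disjoint_of_propertyUWE {T : X →L[ℂ] X} (h : DeltaA T = E T)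
    (hd : Ea T ∩ upperSemiWeylSpectrum T = ∅) :
    Delta T = Ea T ∧ DeltaA T ∩ weylSpectrum T = ∅ := by
  rw [← Set.disjoint_iff_inter_eq_empty] at hd ⊢
  have hEa : Ea T ⊆ DeltaA T := fun z hz ↦ ⟨hz.1.1, Set.disjoint_left.1 hd hz⟩
  have hdisj : ∀ z ∈ DeltaA T, z ∉ weylSpectrum T := fun z hz ↦
    notMem_weylSpectrum_of_mem_isoPts_spectrum (h.subset hz).1 hz.2
  refine ⟨Set.Subset.antisymm ?_ fun z hz ↦ ?_, Set.disjoint_left.2 hdisj⟩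
  · exact (Delta_subset_DeltaA T).trans (h.subset.trans (E_subset_Ea T))
  · exact ⟨approxSpectrum_subset_spectrum T hz.1.1, hdisj z (hEa hz)⟩

lemma propertyUWE_and_disjoint_of_propertyZEa {T : X →L[ℂ] X} (h : Delta T = Ea T)
    (hd : DeltaA T ∩ weylSpectrum T = ∅) :
    DeltaA T = E T ∧ Ea T ∩ upperSemiWeylSpectrum T = ∅ := by
  rw [← Set.disjoint_iff_inter_eq_empty] at hd ⊢
  have hEa : Ea T ⊆ DeltaA T := h.symm.subset.trans (Delta_subset_DeltaA T)
  refine ⟨Set.Subset.antisymm (fun z hz ↦ ?_) ((E_subset_Ea T).trans hEa),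
    Set.disjoint_left.2 fun z hz ↦ (hEa hz).2⟩
  have hw : z ∉ weylSpectrum T := Set.disjoint_left.1 hd hz
  have hz' : z ∈ Ea T := h.subset ⟨approxSpectrum_subset_spectrum T hz.1, hw⟩
  exact ⟨mem_isoPts_spectrum_of_notMem_weylSpectrum hz'.1 hw, hz'.2⟩

end SpectralSets

theorem mainTheorem4 {X : Type*} [NormedAddCommGroup X] [NormedSpace ℂ X] [CompleteSpace X]
    (hX : ¬ FiniteDimensional ℂ X) (T : X →L[ℂ] X) :
    List.TFAE
      [SpectralSets.PropertyUWE T ∧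
          SpectralSets.Ea T ∩ SpectralSets.upperSemiWeylSpectrum T = ∅,
        SpectralSets.PropertyZEa T ∧
          SpectralSets.weylSpectrum T \ SpectralSets.upperSemiWeylSpectrum T =
            spectrum ℂ T \ SpectralSets.approxSpectrum T,
        SpectralSets.PropertyZEa T ∧
          SpectralSets.DeltaA T ∩ SpectralSets.weylSpectrum T = ∅] := by
  tfae_have 2 ↔ 3 := and_congr_right' (SpectralSets.weylSpectrum_diff_eq_iff T)
  tfae_have 1 → 3 := fun h ↦ SpectralSets.propertyZEa_and_disjoint_of_propertyUWE h.1 h.2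
  tfae_have 3 → 1 := fun h ↦ SpectralSets.propertyUWE_and_disjoint_of_propertyZEa h.1 h.2
  tfae_finish
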